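/- Let $X$ be a standard Borel space and let $k \geq 1$ be an integer, identified with the set $\{0,1,\ldots,k-1\}$. An $(X,k)$-constraint $B$ with finite domain $\mathrm{dom}(B) = D \subseteq X$ is a set $B \subseteq k^{D}$ of functions $D \to k$; a function $f \colon X \to k$ violates $B$ if $f|_{D} \in B$. A constraint satisfaction problem (CSP) $\mathscr{B} \colon X \to^? k$ is a set of $(X,k)$-constraints, and a solution to $\mathscr{B}$ is a function $f \colon X \to k$ that violates no $B \in \mathscr{B}$. Put $$\mathsf{p}(\mathscr{B}) = \sup_{B \in \mathscr{B}} \frac{|B|}{k^{|\mathrm{dom}(B)|}}, \qquad \mathsf{vdeg}(\mathscr{B}) = \sup_{x \in X} |\{B \in \mathscr{B} : x \in \mathrm{dom}(B)\}|, \qquad \mathsf{ord}(\mathscr{B}) = \sup_{B \in \mathscr{B}} |\mathrm{dom}(B)|,$$ where $\mathsf{vdeg}(\mathscr{B}), \mathsf{ord}(\mathscr{B}) \in \mathbb{N} \cup \{\infty\}$, the supremum of the empty set is $0$, and we use the conventions $0^0 = 1$, $1^\infty = 1$, and $0 \cdot \infty = 0$. For a measurable space $Y$, let $[Y]^{<\infty}$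 be the set of all finite subsets of $Y$, where $A \subseteq [Y]^{<\infty}$ is Borel if for every $n \in \mathbb{N}$ the set $\{(y_1,\ldots,y_n) \in Y^n : \{y_1,\ldots,y_n\} \in A\}$ is measurable in $Y^n$. Identifying functions with their graphs, every $(X,k)$-constraint is a finite subset of $[X \times k]^{<\infty}$; the CSP $\mathscr{B}$ is Borel if it is a Borel subset of $[[X \times k]^{<\infty}]^{<\infty}$. If $\mathscr{B} \colon X \to^? k$ is a Borel CSP on the standard Borel space $X$ such that $$\mathsf{p}(\mathscr{B}) \cdot \mathsf{vdeg}(\mathscr{B})^{\mathsf{ord}(\mathscr{B})} < 1,$$ then $\mathscr{B}$ has a Borel solution $f \colon X \to k$. -/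

import Mathlib

open scoped ENNReal MeasureTheory

/-- The natural Borel structure on the set of finite subsets of `α`: the quotient structure
induced by the maps `(x₁, …, xₙ) ↦ {x₁, …, xₙ}` from the spaces `αⁿ`, `n ∈ ℕ`. A set `A` of finite
subsets is Borel if and only if `{(x₁, …, xₙ) | {x₁, …, xₙ} ∈ A}` is Borel in `αⁿ` for every `n`.
(Mathlib's instance on `Finset α` is generated by the events `a ∈ F` for single points `a` only,
which is too coarse when `α` is uncountable, so it is not used.) -/
@[reducible]
noncomputable def finsetBorel (α : Type*) (m : MeasurableSpace α) : MeasurableSpace (Finset α) :=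
  open scoped Classical in
  ⨅ n : ℕ, MeasurableSpace.map (fun x : Fin n → α => Finset.univ.image x)
    (@MeasurableSpace.pi (Fin n) (fun _ => α) fun _ => m)

/-- An `(X, k)`-constraint: a finite domain `D ⊆ X` with a set `B ⊆ k^D` of `k`-colorings of `D`
(the forbidden patterns). -/
structure Constraint (X : Type*) (k : ℕ) where
  dom : Finset X
  patterns : Finset (dom → Fin k)

namespace Constraint

variable {X : Type*} {k : ℕ}

/-- `f` violates `B` if the restriction of `f` to the domain of `B` is in `B`. -/
def Violates (f : X → Fin k) (B : Constraint X k) : Prop :=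
  (fun x : B.dom => f x) ∈ B.patterns

/-- `P[B] = |B| / k^|dom(B)|`. -/
noncomputable def prob (B : Constraint X k) : ℝ≥0∞ :=
  (B.patterns.card : ℝ≥0∞) / (k : ℝ≥0∞) ^ B.dom.card

/-- A `k`-coloring of a finite set `D`, viewed as a finite subset of `X × k` (its graph). -/
noncomputable def graph {D : Finset X} (φ : D → Fin k) : Finset (X × Fin k) :=
  open scoped Classical in
  Finset.univ.image fun x : D => ((x : X), φ x)

/-- A constraint viewed as a finite set of finite subsets of `X × k`. -/
noncomputable def code (B : Constraint X k) : Finset (Finset (X × Fin k)) :=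
  open scoped Classical in
  B.patterns.image graph

end Constraint

/-- A constraint satisfaction problem on `X` with range `k`: a set of `(X, k)`-constraints. -/
abbrev CSP (X : Type*) (k : ℕ) := Set (Constraint X k)

namespace CSP

variable {X : Type*} {k : ℕ}

/-- `p(𝓑) = sup_{B ∈ 𝓑} P[B]`. -/
noncomputable def p (𝓑 : CSP X k) : ℝ≥0∞ := ⨆ B ∈ 𝓑, B.prob

/-- The maximum vertex-degree `sup_{x ∈ X} |{B ∈ 𝓑 : x ∈ dom(B)}|`, possibly infinite. -/
noncomputable def vdeg (𝓑 : CSP X k) : ℕ∞ := ⨆ x : X, Set.encard {B ∈ 𝓑 | x ∈ B.dom}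

/-- The order `sup_{B ∈ 𝓑} |dom(B)|`, possibly infinite. -/
noncomputable def ord (𝓑 : CSP X k) : ℕ∞ := ⨆ B ∈ 𝓑, (B.dom.card : ℕ∞)

/-- A solution is a `k`-coloring of `X` that violates no constraint. -/
def IsSolution (𝓑 : CSP X k) (f : X → Fin k) : Prop := ∀ B ∈ 𝓑, ¬ B.Violates f

/-- A CSP is Borel if it is a Borel subset of the space of finite sets of finite subsets
of `X × k`. -/
def IsBorel [MeasurableSpace X] (𝓑 : CSP X k) : Prop :=
  MeasurableSet[finsetBorel (Finset (X × Fin k)) (finsetBorel (X × Fin k) inferInstance)]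
    (Constraint.code '' 𝓑)

end CSP

open scoped ENNReal MeasureTheory

/-! The proof runs the method of conditional probabilities in a Borel way. Let d bound the vertex
degrees. When a value at a point x is chosen, the new conditional probability of a constraint at x
averages to the old one, so by Markov's inequality less than a 1/d fraction of the values makes it
more than d times larger. At most d constraints contain x, so some value is good for all of them
(`exists_forall_mul_le`). Once dom(B) is decided, the conditional probability of B is at most
|B|/k^|dom(B)| · d^|dom(B)| < 1; being 0 or 1, it is 0.

To make the choices Borel, points get natural number colors, distinct within each constraint that
has a pattern (`exists_measurable_coloring`). All points of one color are then treated
simultaneously without interference (`exists_measurable_step`). Quantifying over the constraints at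
a point stays Borel because constraints are parametrized by tuples, boundedly many of each shape
through a point, and bounded-to-one Borel images are Borel
(`measurableSet_image_of_encard_fiber_le`). -/

/-! ### Borel images under bounded-to-one maps. -/

/-- The image of a Borel set under a Borel map with fibers of bounded size is Borel. -/
theorem measurableSet_image_of_encard_fiber_le {X Y : Type*} [MeasurableSpace X]
    [StandardBorelSpace X] [MeasurableSpace Y] [StandardBorelSpace Y] {f : Y → X}
    (hf : Measurable f) (m : ℕ) {A : Set Y} (hA : MeasurableSet A)
    (h : ∀ x, (A ∩ f ⁻¹' {x}).encard ≤ m) : MeasurableSet (f '' A) := by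
  classical
  induction m generalizing A with
  | zero =>
    have : A = ∅ := by
      by_contra hne
      obtain ⟨y, hy⟩ := Set.nonempty_iff_ne_empty.mpr hne
      have h0 := h (f y)
      rw [Nat.cast_zero, nonpos_iff_eq_zero, Set.encard_eq_zero] at h0
      exact (h0 ▸ (⟨hy, rfl⟩ : y ∈ A ∩ f ⁻¹' {f y}) : y ∈ (∅ : Set Y))
    simp [this]
  | succ m ih =>
    let e := MeasureTheory.embeddingReal Y
    have he := MeasureTheory.measurableEmbedding_embeddingReal Y
    -- The Borel order pulled back from ℝ lists each fiber of the maximal size m + 1 exactly once,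
    -- so projecting `T` to `X` is injective and Lusin–Souslin applies. Off these fibers the bound
    -- drops to m.
    let T : Set (Fin (m + 1) → Y) :=
      {t | (∀ i, t i ∈ A) ∧ (∀ i, f (t i) = f (t 0)) ∧ ∀ i j, i < j → e (t i) < e (t j)}
    have hT : MeasurableSet T := by
      have h1 : MeasurableSet {t : Fin (m + 1) → Y | ∀ i, t i ∈ A} := by
        rw [Set.ofPred_forall]
        exact MeasurableSet.iInter fun i => measurable_pi_apply i hA
      have h2 : MeasurableSet {t : Fin (m + 1) → Y | ∀ i, f (t i) = f (t 0)} := by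
        rw [Set.ofPred_forall]
        exact MeasurableSet.iInter fun i => measurableSet_eq_fun
          (hf.comp (measurable_pi_apply i)) (hf.comp (measurable_pi_apply 0))
      have h3 : MeasurableSet {t : Fin (m + 1) → Y | ∀ i j, i < j → e (t i) < e (t j)} := by
        simp only [Set.ofPred_forall]
        exact MeasurableSet.iInter fun i => MeasurableSet.iInter fun j =>
          MeasurableSet.iInter fun _ => measurableSet_lt
            (he.measurable.comp (measurable_pi_apply i)) (he.measurable.comp (measurable_pi_apply j))
      exact h1.inter (h2.inter h3)
    have hmono : ∀ t ∈ T, StrictMono (e ∘ t) := fun t ht i j hij => ht.2.2 i j hij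
    have hcard : ∀ t ∈ T, (Set.range t).encard = ((m + 1 : ℕ) : ℕ∞) := fun t ht => by
      have hinj : Function.Injective t := (hmono t ht).injective.of_comp
      rw [← Set.image_univ, hinj.encard_image]
      simp
    have hrange : ∀ t ∈ T, Set.range t = A ∩ f ⁻¹' {f (t 0)} := fun t ht => by
      have hsub : Set.range t ⊆ A ∩ f ⁻¹' {f (t 0)} := by
        rintro _ ⟨i, rfl⟩
        exact ⟨ht.1 i, ht.2.1 i⟩
      have hfin : (Set.range t).Finite := Set.finite_range t
      exact hfin.eq_of_subset_of_encard_le hsub ((h _).trans (hcard t ht).ge)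
    have hE : MeasurableSet ((fun t : Fin (m + 1) → Y => f (t 0)) '' T) := by
      refine hT.image_of_measurable_injOn (hf.comp (measurable_pi_apply 0)) ?_
      intro t ht s hs hts
      have hr : Set.range t = Set.range s := by
        rw [hrange t ht, hrange s hs]
        simp only at hts
        rw [hts]
      have : e ∘ t = e ∘ s := by
        rw [← (hmono t ht).range_inj (hmono s hs), Set.range_comp, Set.range_comp, hr]
      exact he.injective.comp_left this
    set E := (fun t : Fin (m + 1) → Y => f (t 0)) '' T with hEdef
    have hA' : MeasurableSet (A \ f ⁻¹' E) := hA.diff (hf hE)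
    have hb : ∀ x, ((A \ f ⁻¹' E) ∩ f ⁻¹' {x}).encard ≤ m := by
      intro x
      by_contra hlt
      rw [not_le] at hlt
      have hle := Order.add_one_le_of_lt hlt
      obtain ⟨s, hs, hscard⟩ := Set.exists_subset_encard_eq hle
      have hsfin : s.Finite := Set.finite_of_encard_eq_coe
        (k := m + 1) (by rw [hscard]; norm_cast)
      obtain ⟨s, rfl⟩ := hsfin.exists_finset_coe
      have hsc : (s.image e).card = m + 1 := by
        rw [Finset.card_image_of_injective _ he.injective]
        rw [Set.encard_coe_eq_coe_finsetCard] at hscard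
        exact_mod_cast hscard
      let o := (s.image e).orderEmbOfFin hsc
      have ho : ∀ i, ∃ y ∈ s, e y = o i := fun i => by
        exact Finset.mem_image.mp (Finset.orderEmbOfFin_mem (s.image e) hsc i)
      choose t hts hto using ho
      have htT : t ∈ T := by
        refine ⟨fun i => (hs (hts i)).1.1, fun i => ?_, fun i j hij => ?_⟩
        · rw [show f (t i) = x from (hs (hts i)).2, show f (t 0) = x from (hs (hts 0)).2]
        · rw [hto, hto]
          exact o.strictMono hij
      exact (hs (hts 0)).1.2 ⟨t, htT, rfl⟩
    have hunion : f '' A = E ∪ f '' (A \ f ⁻¹' E) := by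
      ext x
      constructor
      · rintro ⟨y, hy, rfl⟩
        by_cases hyE : f y ∈ E
        · exact Or.inl hyE
        · exact Or.inr ⟨y, ⟨hy, hyE⟩, rfl⟩
      · rintro (⟨t, ht, rfl⟩ | ⟨y, hy, rfl⟩)
        · exact ⟨t 0, ht.1 0, rfl⟩
        · exact ⟨y, hy.1, rfl⟩
    rw [hunion]
    exact hE.union (ih hA' hb)

theorem measurableSet_setOf_injective {X : Type*} [MeasurableSpace X] [StandardBorelSpace X]
    (n : ℕ) : MeasurableSet {t : Fin n → X | Function.Injective t} := by
  have : {t : Fin n → X | Function.Injective t} = {t | ∀ i j, i ≠ j → t i ≠ t j} := by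
    ext t
    exact ⟨fun h i j hij => h.ne hij, fun h i j => not_imp_not.mp (h i j)⟩
  rw [this]
  simp only [Set.ofPred_forall]
  exact MeasurableSet.iInter fun i => MeasurableSet.iInter fun j => MeasurableSet.iInter fun _ =>
    (measurableSet_eq_fun (measurable_pi_apply i) (measurable_pi_apply j)).compl

theorem measurable_finsetImage {α : Type*} [DecidableEq α] (m : MeasurableSpace α) (n : ℕ) :
    @Measurable (Fin n → α) (Finset α) (@MeasurableSpace.pi (Fin n) (fun _ => α) fun _ => m)
      (finsetBorel α m) (fun x => Finset.univ.image x) := by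
  intro s hs
  have := MeasurableSpace.map_def.mp (MeasurableSpace.measurableSet_iInf.mp hs n)
  convert this

/-! ### Constraints parametrized by injective tuples. -/

namespace Constraint

variable {X : Type*} {k : ℕ}

/-- The constraint whose domain is the range of the tuple `t` and whose patterns are given by `P`
along `t`. -/
noncomputable def ofTuple {n : ℕ} (t : Fin n → X) (P : Finset (Fin n → Fin k)) :
    Constraint X k :=
  open scoped Classical in
  { dom := Finset.univ.image t
    patterns := Finset.univ.filter fun ψ =>
      (fun i => ψ ⟨t i, Finset.mem_image_of_mem t (Finset.mem_univ i)⟩) ∈ P }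

theorem mem_dom_ofTuple {n : ℕ} {t : Fin n → X} {P : Finset (Fin n → Fin k)} {x : X} :
    x ∈ (ofTuple t P).dom ↔ ∃ i, t i = x := by
  simp [ofTuple]

theorem mem_patterns_ofTuple {n : ℕ} {t : Fin n → X} {P : Finset (Fin n → Fin k)}
    {ψ : (ofTuple t P).dom → Fin k} :
    ψ ∈ (ofTuple t P).patterns ↔ (fun i => ψ ⟨t i, mem_dom_ofTuple.mpr ⟨i, rfl⟩⟩) ∈ P := by
  classical
  exact Finset.mem_filter.trans (and_iff_right (Finset.mem_univ _))

/-- An injective tuple as a parametrization of the domain of its constraint. -/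
noncomputable def tupleEquiv {n : ℕ} {t : Fin n → X} (ht : Function.Injective t)
    (P : Finset (Fin n → Fin k)) : Fin n ≃ (ofTuple t P).dom :=
  Equiv.ofBijective (fun i => ⟨t i, mem_dom_ofTuple.mpr ⟨i, rfl⟩⟩)
    ⟨fun _ _ hij => ht (congrArg Subtype.val hij), fun ⟨_, hy⟩ =>
      (mem_dom_ofTuple.mp hy).imp fun _ hi => Subtype.ext hi⟩

theorem mem_patterns_ofTuple_iff {n : ℕ} {t : Fin n → X} (ht : Function.Injective t)
    {P : Finset (Fin n → Fin k)} {ψ : (ofTuple t P).dom → Fin k} :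
    ψ ∈ (ofTuple t P).patterns ↔ ψ ∘ tupleEquiv ht P ∈ P :=
  mem_patterns_ofTuple

theorem exists_eq_ofTuple (B : Constraint X k) :
    ∃ (n : ℕ) (t : Fin n → X) (P : Finset (Fin n → Fin k)),
      Function.Injective t ∧ B = ofTuple t P := by
  classical
  obtain ⟨D, S⟩ := B
  let e := D.equivFin.symm
  refine ⟨D.card, fun i => (e i : X), S.image fun ψ => ψ ∘ e,
    Subtype.val_injective.comp e.injective, ?_⟩
  set t : Fin D.card → X := fun i => (e i : X) with ht
  -- The domain is generalized to a variable `D'` so that the equality of domains can be substituted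
  -- in the dependent pattern type.
  have key : ∀ (D' : Finset X) (hD : D = D') (S' : Finset (D' → Fin k)),
      (∀ ψ : D' → Fin k, ψ ∈ S' ↔ (fun y : D => ψ ⟨y, hD ▸ y.2⟩) ∈ S) →
      (⟨D, S⟩ : Constraint X k) = ⟨D', S'⟩ := by
    rintro _ rfl S' h
    congr 1
    ext ψ
    exact (h ψ).symm
  have hD : D = Finset.univ.image t := by
    ext x
    simp only [Finset.mem_image, Finset.mem_univ, true_and, ht]
    exact ⟨fun hx => ⟨e.symm ⟨x, hx⟩, by simp⟩, by rintro ⟨i, rfl⟩; exact (e i).2⟩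
  refine (key _ hD _ fun ψ => ?_).trans (by rfl)
  rw [Finset.mem_filter]
  simp only [Finset.mem_univ, true_and, Finset.mem_image]
  constructor
  · rintro ⟨φ, hφ, h⟩
    convert hφ using 1
    ext y
    have := congrFun h (e.symm y)
    simp only [Function.comp_apply, Equiv.apply_symm_apply] at this
    rw [this]
    simp [ht]
  · intro h
    exact ⟨_, h, rfl⟩

theorem mem_graph {D : Finset X} {φ : D → Fin k} {x : X} {a : Fin k} :
    (x, a) ∈ graph φ ↔ ∃ h : x ∈ D, φ ⟨x, h⟩ = a := by
  simp [graph]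

theorem dom_eq_of_graph_eq {D D' : Finset X} {φ : D → Fin k} {φ' : D' → Fin k}
    (h : graph φ = graph φ') : D = D' := by
  ext x
  constructor
  · intro hx
    have : (x, φ ⟨x, hx⟩) ∈ graph φ := mem_graph.mpr ⟨hx, rfl⟩
    rw [h] at this
    exact (mem_graph.mp this).1
  · intro hx
    have : (x, φ' ⟨x, hx⟩) ∈ graph φ' := mem_graph.mpr ⟨hx, rfl⟩
    rw [← h] at this
    exact (mem_graph.mp this).1

theorem graph_injective {D : Finset X} : Function.Injective (graph (X := X) (k := k) (D := D)) := by
  intro φ φ' h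
  ext1 x
  have : ((x : X), φ x) ∈ graph φ := mem_graph.mpr ⟨x.2, rfl⟩
  rw [h] at this
  exact (mem_graph.mp this).2.symm

theorem mem_code {B : Constraint X k} {s : Finset (X × Fin k)} :
    s ∈ B.code ↔ ∃ ψ ∈ B.patterns, graph ψ = s := by
  simp [code]

/-- A constraint with at least one pattern is determined by its code. -/
theorem eq_of_code_eq {B B' : Constraint X k} (hB : B.patterns.Nonempty)
    (h : B.code = B'.code) : B = B' := by
  obtain ⟨ψ, hψ⟩ := hB
  have h1 : graph ψ ∈ B.code := mem_code.mpr ⟨ψ, hψ, rfl⟩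
  rw [h] at h1
  obtain ⟨ψ', _, hg⟩ := mem_code.mp h1
  obtain ⟨D, S⟩ := B
  obtain ⟨D', S'⟩ := B'
  obtain rfl : D' = D := dom_eq_of_graph_eq hg
  congr 1
  classical
  exact Finset.image_injective graph_injective (by simpa [code] using h)

/-- With the patterns enumerated by a fixed `φ`, the code becomes nested images of tuples, which is
a Borel function of `t`. -/
theorem code_ofTuple {n m : ℕ} {t : Fin n → X} (ht : Function.Injective t)
    {P : Finset (Fin n → Fin k)} (φ : Fin m → Fin n → Fin k)
    [DecidableEq (X × Fin k)] [DecidableEq (Finset (X × Fin k))]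
    (hφ : ∀ ψ, ψ ∈ P ↔ ∃ j, φ j = ψ) :
    (ofTuple t P).code =
      Finset.univ.image fun j => Finset.univ.image fun i => (t i, φ j i) := by
  have hg : ∀ ψ : (ofTuple t P).dom → Fin k,
      graph ψ = Finset.univ.image fun i => (t i, (ψ ∘ tupleEquiv ht P) i) := by
    intro ψ
    ext ⟨x, a⟩
    rw [mem_graph]
    simp only [Finset.mem_image, Finset.mem_univ, true_and, Prod.mk.injEq]
    constructor
    · rintro ⟨h, rfl⟩
      obtain ⟨i, rfl⟩ := mem_dom_ofTuple.mp h
      exact ⟨i, rfl, rfl⟩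
    · rintro ⟨i, rfl, rfl⟩
      exact ⟨mem_dom_ofTuple.mpr ⟨i, rfl⟩, rfl⟩
  ext s
  rw [mem_code]
  simp only [Finset.mem_image, Finset.mem_univ, true_and]
  constructor
  · rintro ⟨ψ, hψ, rfl⟩
    obtain ⟨j, hj⟩ := (hφ _).mp ((mem_patterns_ofTuple_iff ht).mp hψ)
    exact ⟨j, by rw [hg, hj]⟩
  · rintro ⟨j, rfl⟩
    have hj : (φ j ∘ (tupleEquiv ht P).symm) ∘ tupleEquiv ht P = φ j := by
      rw [Function.comp_assoc, Equiv.symm_comp_self, Function.comp_id]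
    refine ⟨φ j ∘ (tupleEquiv ht P).symm, ?_, ?_⟩
    · rw [mem_patterns_ofTuple_iff ht, hj]
      exact (hφ _).mpr ⟨j, rfl⟩
    · rw [hg, hj]

theorem patterns_ofTuple_nonempty {n : ℕ} {t : Fin n → X} (ht : Function.Injective t)
    {P : Finset (Fin n → Fin k)} : (ofTuple t P).patterns.Nonempty ↔ P.Nonempty := by
  constructor
  · rintro ⟨ψ, hψ⟩
    exact ⟨_, mem_patterns_ofTuple.mp hψ⟩
  · rintro ⟨φ, hφ⟩
    refine ⟨φ ∘ (tupleEquiv ht P).symm, ?_⟩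
    rwa [mem_patterns_ofTuple_iff ht, Function.comp_assoc, Equiv.symm_comp_self, Function.comp_id]

end Constraint

/-! ### Borel quantification over the constraints at a point. -/

namespace CSP

open Constraint

variable {X : Type*} {k : ℕ} {𝓑 : CSP X k}

/-- Such a tuple takes values in a domain of exactly n points, which leaves at most n^n tuples for
each of the at most d constraints at `x`. -/
theorem encard_tuples_le {d : ℕ} (hd : ∀ x, Set.encard {B ∈ 𝓑 | x ∈ B.dom} ≤ d) {n : ℕ}
    (P : Finset (Fin n → Fin k)) (i : Fin n) (x : X) :
    {t : Fin n → X | Function.Injective t ∧ ofTuple t P ∈ 𝓑 ∧ t i = x}.encard ≤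
      (d * n ^ n : ℕ) := by
  classical
  have hfin : {B ∈ 𝓑 | x ∈ B.dom}.Finite := Set.finite_of_encard_le_coe (hd x)
  let S : Finset (Constraint X k) := hfin.toFinset.filter fun B => B.dom.card = n
  have hS : S.card ≤ d := by
    refine (Finset.card_filter_le _ _).trans ?_
    have := hd x
    rw [hfin.encard_eq_coe_toFinset_card] at this
    exact_mod_cast this
  have hsub : {t : Fin n → X | Function.Injective t ∧ ofTuple t P ∈ 𝓑 ∧ t i = x} ⊆
      (S.biUnion fun B => Fintype.piFinset fun _ : Fin n => B.dom : Finset (Fin n → X)) := by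
    rintro t ⟨ht, hB, hx⟩
    simp only [Finset.coe_biUnion, Set.mem_iUnion, Finset.mem_coe]
    refine ⟨ofTuple t P, ?_, ?_⟩
    · simp only [S, Finset.mem_filter, Set.Finite.mem_toFinset, Set.mem_ofPred_eq]
      refine ⟨⟨hB, mem_dom_ofTuple.mpr ⟨i, hx⟩⟩, ?_⟩
      rw [← Fintype.card_coe, ← Fintype.card_congr (tupleEquiv ht P), Fintype.card_fin]
    · rw [Fintype.mem_piFinset]
      exact fun j => mem_dom_ofTuple.mpr ⟨j, rfl⟩
  refine (Set.encard_le_encard hsub).trans ?_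
  rw [Set.encard_coe_eq_coe_finsetCard]
  norm_cast
  refine (Finset.card_biUnion_le_card_mul _ _ (n ^ n) fun B hB => ?_).trans
    (Nat.mul_le_mul_right _ hS)
  rw [Fintype.card_piFinset_const, (Finset.mem_filter.mp hB).2]

variable [MeasurableSpace X] [StandardBorelSpace X]

/-- Nonemptiness of `P` is essential: all constraints without patterns share the code ∅, so
Borelness of the CSP does not control them. They are never violated and can be ignored. -/
theorem IsBorel.measurableSet_ofTuple_mem (hB : 𝓑.IsBorel) {n : ℕ} {P : Finset (Fin n → Fin k)}
    (hP : P.Nonempty) :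
    MeasurableSet {t : Fin n → X | Function.Injective t ∧ ofTuple t P ∈ 𝓑} := by
  classical
  let φ : Fin P.card → Fin n → Fin k := fun j => (P.equivFin.symm j : Fin n → Fin k)
  have hφ : ∀ ψ, ψ ∈ P ↔ ∃ j, φ j = ψ := fun ψ =>
    ⟨fun h => ⟨P.equivFin ⟨ψ, h⟩, by simp [φ]⟩, by rintro ⟨j, rfl⟩; exact (P.equivFin.symm j).2⟩
  have hmeas : @Measurable (Fin n → X) (Finset (Finset (X × Fin k))) _
      (finsetBorel (Finset (X × Fin k)) (finsetBorel (X × Fin k) inferInstance))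
      (fun t => Finset.univ.image fun j => Finset.univ.image fun i => (t i, φ j i)) := by
    let _ : MeasurableSpace (Finset (X × Fin k)) := finsetBorel (X × Fin k) inferInstance
    refine (measurable_finsetImage (finsetBorel (X × Fin k) inferInstance) P.card).comp
      (measurable_pi_lambda _ fun j => ?_)
    refine (measurable_finsetImage (α := X × Fin k) inferInstance n).comp
      (measurable_pi_lambda _ fun i => ?_)
    exact (measurable_pi_apply i).prodMk measurable_const
  have hset : {t : Fin n → X | Function.Injective t ∧ ofTuple t P ∈ 𝓑} =
      {t | Function.Injective t} ∩
        (fun t => Finset.univ.image fun j => Finset.univ.image fun i => (t i, φ j i)) ⁻¹'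
          (code '' 𝓑) := by
    ext t
    refine and_congr_right fun ht => ?_
    rw [Set.mem_preimage, ← code_ofTuple ht φ hφ]
    constructor
    · exact fun h => ⟨_, h, rfl⟩
    · rintro ⟨B, hB, h⟩
      rwa [eq_of_code_eq ((patterns_ofTuple_nonempty ht).mpr hP) h.symm]
  rw [hset]
  exact (measurableSet_setOf_injective n).inter (hmeas hB)

/-- A property of points that asks for a nontrivial constraint at the point is Borel as soon as it
is Borel along tuples parametrizing constraints. -/
theorem IsBorel.measurableSet_exists_constraint (hB : 𝓑.IsBorel) {d : ℕ}
    (hd : ∀ x, Set.encard {B ∈ 𝓑 | x ∈ B.dom} ≤ d) (Q : Constraint X k → X → Prop)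
    (hQ : ∀ (n : ℕ) (P : Finset (Fin n → Fin k)) (i : Fin n),
      MeasurableSet {t : Fin n → X | Function.Injective t ∧ Q (ofTuple t P) (t i)}) :
    MeasurableSet {x | ∃ B ∈ 𝓑, B.patterns.Nonempty ∧ x ∈ B.dom ∧ Q B x} := by
  have hset : {x | ∃ B ∈ 𝓑, B.patterns.Nonempty ∧ x ∈ B.dom ∧ Q B x} =
      ⋃ (n : ℕ) (P : Finset (Fin n → Fin k)) (_ : P.Nonempty) (i : Fin n),
        (fun t : Fin n → X => t i) '' ({t | Function.Injective t ∧ ofTuple t P ∈ 𝓑} ∩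
          {t | Function.Injective t ∧ Q (ofTuple t P) (t i)}) := by
    ext x
    simp only [Set.mem_iUnion, Set.mem_ofPred_eq]
    constructor
    · rintro ⟨B, hB, hne, hx, hQx⟩
      obtain ⟨n, t, P, ht, rfl⟩ := B.exists_eq_ofTuple
      obtain ⟨i, rfl⟩ := mem_dom_ofTuple.mp hx
      exact ⟨n, P, (patterns_ofTuple_nonempty ht).mp hne, i, t, ⟨⟨ht, hB⟩, ht, hQx⟩, rfl⟩
    · rintro ⟨n, P, hP, i, t, ⟨⟨ht, hB⟩, -, hQx⟩, rfl⟩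
      exact ⟨_, hB, (patterns_ofTuple_nonempty ht).mpr hP, mem_dom_ofTuple.mpr ⟨i, rfl⟩, hQx⟩
  rw [hset]
  refine MeasurableSet.iUnion fun n => MeasurableSet.iUnion fun P => MeasurableSet.iUnion fun hP =>
    MeasurableSet.iUnion fun i => ?_
  refine measurableSet_image_of_encard_fiber_le (measurable_pi_apply i) (d * n ^ n)
    ((hB.measurableSet_ofTuple_mem hP).inter (hQ n P i)) fun x => ?_
  refine (Set.encard_le_encard ?_).trans (encard_tuples_le hd P i x)
  rintro t ⟨⟨⟨ht, hB⟩, -⟩, hx⟩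
  exact ⟨ht, hB, hx⟩

end CSP

/-! ### Counting compatible patterns, and the one-point choice. -/

namespace Constraint

variable {X : Type*} {k : ℕ}

open scoped Classical in
/-- The number of patterns of `B` that agree with `f` at the points of the domain where `R`
holds. -/
noncomputable def count (B : Constraint X k) (R : X → Prop) (f : X → Fin k) : ℕ :=
  (B.patterns.filter fun ψ => ∀ y : B.dom, R y → ψ y = f y).card

theorem count_le (B : Constraint X k) (R : X → Prop) (f : X → Fin k) :
    B.count R f ≤ B.patterns.card := by
  classical
  exact Finset.card_filter_le _ _

theorem Violates.count_pos {B : Constraint X k} {f g : X → Fin k} (h : Violates g B)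
    {R : X → Prop} (hfg : ∀ y ∈ B.dom, R y → g y = f y) : 0 < B.count R f := by
  classical
  exact Finset.card_pos.mpr ⟨_, Finset.mem_filter.mpr ⟨h, fun y hy => hfg y y.2 hy⟩⟩

theorem count_congr (B : Constraint X k) {R R' : X → Prop} {f f' : X → Fin k}
    (hR : ∀ y ∈ B.dom, R y ↔ R' y) (hf : ∀ y ∈ B.dom, R y → f y = f' y) :
    B.count R f = B.count R' f' := by
  classical
  unfold count
  congr 1
  refine Finset.filter_congr fun ψ _ => forall_congr' fun y => ?_
  rw [← hR y y.2]
  exact forall_congr' fun h => by rw [hf y y.2 h]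

-- For fixed `P` the count depends on `t` only through `R` and `f` along `t`, which gives
-- measurability in `t`.
open scoped Classical in
theorem count_ofTuple {n : ℕ} {t : Fin n → X} (ht : Function.Injective t)
    (P : Finset (Fin n → Fin k)) (R : X → Prop) (f : X → Fin k) :
    (ofTuple t P).count R f = (P.filter fun φ => ∀ i, R (t i) → φ i = f (t i)).card := by
  unfold count
  refine Finset.card_equiv ((tupleEquiv ht P).symm.arrowCongr (Equiv.refl _)) fun ψ => ?_
  have h : (tupleEquiv ht P).symm.arrowCongr (Equiv.refl _) ψ = ψ ∘ tupleEquiv ht P := by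
    ext i
    simp [Equiv.arrowCongr]
  rw [Finset.mem_filter, Finset.mem_filter, mem_patterns_ofTuple_iff ht, h]
  refine and_congr_right fun _ => ?_
  rw [← (tupleEquiv ht P).forall_congr_right]
  rfl

/-- Law of total probability: each compatible pattern is counted for exactly one `a`, its own value
at `x`. -/
theorem sum_count_update (B : Constraint X k) (R : X → Prop) (f : X → Fin k) {x : X}
    [DecidableEq X] (hx : x ∈ B.dom) (hR : ¬ R x) :
    ∑ a, B.count (fun y => R y ∨ y = x) (Function.update f x a) = B.count R f := by
  classical
  unfold count
  rw [Finset.card_eq_sum_card_fiberwise (f := fun ψ => ψ ⟨x, hx⟩) (t := Finset.univ)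
    fun _ _ => Finset.mem_coe.mpr (Finset.mem_univ _)]
  refine Finset.sum_congr rfl fun a _ => ?_
  rw [Finset.filter_filter]
  congr 1
  ext ψ
  simp only [Finset.mem_filter]
  refine and_congr_right fun _ => ?_
  constructor
  · intro h
    refine ⟨fun y hy => ?_, by simpa using h ⟨x, hx⟩ (Or.inr rfl)⟩
    have hne : (y : X) ≠ x := fun e => hR (e ▸ hy)
    simpa [Function.update_of_ne hne] using h y (Or.inl hy)
  · rintro ⟨h, ha⟩ y hy
    by_cases hyx : (y : X) = x
    · obtain rfl : y = ⟨x, hx⟩ := Subtype.ext hyx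
      simpa using ha
    · rw [Function.update_of_ne hyx]
      exact h y (hy.resolve_right hyx)

/-- If a family of at most `d` functions on `Fin k` is given, some point makes each of them at most
`d` times its average. -/
theorem exists_forall_mul_le {ι : Type*} (S : Finset ι) {d : ℕ} (hd : S.card ≤ d) (hk : 0 < k)
    (N : ι → Fin k → ℕ) : ∃ a, ∀ B ∈ S, N B a * k ≤ d * ∑ b, N B b := by
  classical
  by_contra hcon
  push Not at hcon
  -- Markov's inequality, strict even when no value is bad because k > 0.
  have hbad : ∀ B ∈ S, (Finset.univ.filter fun a => d * ∑ b, N B b < N B a * k).card * d < k := by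
    intro B _
    set bad := Finset.univ.filter fun a => d * ∑ b, N B b < N B a * k
    rcases bad.eq_empty_or_nonempty with he | hne
    · simpa [he] using hk
    · have h1 : ∑ _a ∈ bad, d * ∑ b, N B b < ∑ a ∈ bad, N B a * k :=
        Finset.sum_lt_sum_of_nonempty hne fun a ha => (Finset.mem_filter.mp ha).2
      have h2 : ∑ a ∈ bad, N B a * k ≤ (∑ b, N B b) * k := by
        rw [← Finset.sum_mul]
        exact Nat.mul_le_mul_right _ (Finset.sum_le_sum_of_subset (Finset.subset_univ _))
      rw [Finset.sum_const, smul_eq_mul, ← mul_assoc] at h1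
      have h3 := h1.trans_le h2
      rw [mul_comm _ k] at h3
      exact lt_of_mul_lt_mul_right h3 (Nat.zero_le _)
  have hcover : (Finset.univ : Finset (Fin k)) ⊆
      S.biUnion fun B => Finset.univ.filter fun a => d * ∑ b, N B b < N B a * k := by
    intro a _
    obtain ⟨B, hB, h⟩ := hcon a
    exact Finset.mem_biUnion.mpr ⟨B, hB, Finset.mem_filter.mpr ⟨Finset.mem_univ _, h⟩⟩
  have hS : S.Nonempty := by
    obtain ⟨B, hB, _⟩ := hcon ⟨0, hk⟩
    exact ⟨B, hB⟩
  have h1 := (Finset.card_le_card hcover).trans Finset.card_biUnion_le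
  rw [Finset.card_univ, Fintype.card_fin] at h1
  have h2 := Finset.sum_lt_sum_of_nonempty hS hbad
  rw [← Finset.sum_mul, Finset.sum_const, smul_eq_mul] at h2
  have h3 := (Nat.mul_le_mul_right d h1).trans_lt h2
  have h4 := Nat.mul_le_mul_right k hd
  rw [mul_comm d k] at h4
  omega

end Constraint

/-! ### Borel selection, coloring, and the greedy construction. -/

/-- A finite-valued Borel selector for finitely many Borel sets. -/
theorem exists_measurable_selector {X : Type*} [MeasurableSpace X] {k : ℕ}
    (G : Fin k → Set X) (hG : ∀ a, MeasurableSet (G a)) (hex : ∀ x, ∃ a, x ∈ G a) :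
    ∃ g : X → Fin k, Measurable g ∧ ∀ x, x ∈ G (g x) := by
  classical
  have hp : ∀ x, ∃ j, ∃ h : j < k, x ∈ G ⟨j, h⟩ := fun x =>
    let ⟨a, ha⟩ := hex x
    ⟨a, a.2, ha⟩
  have hm := measurable_find hp fun j => by
    by_cases h : j < k
    · simpa [h] using hG ⟨j, h⟩
    · simp [h]
  refine ⟨fun x => ⟨Nat.find (hp x), (Nat.find_spec (hp x)).1⟩, ?_,
    fun x => (Nat.find_spec (hp x)).2⟩
  refine measurable_to_countable' fun a => ?_
  have : (fun x => (⟨Nat.find (hp x), (Nat.find_spec (hp x)).1⟩ : Fin k)) ⁻¹' {a} =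
      (fun x => Nat.find (hp x)) ⁻¹' {(a : ℕ)} := by
    ext x
    simp [Fin.ext_iff]
  rw [this]
  exact hm (measurableSet_singleton _)

namespace CSP

open Constraint

variable {X : Type*} {k : ℕ} {𝓑 : CSP X k} [MeasurableSpace X] [StandardBorelSpace X]

/-- A Borel coloring by natural numbers in which distinct points of the domain of a nontrivial
constraint receive distinct colors. -/
theorem IsBorel.exists_measurable_coloring (hB : 𝓑.IsBorel) {d : ℕ}
    (hd : ∀ x, Set.encard {B ∈ 𝓑 | x ∈ B.dom} ≤ d) :
    ∃ c : X → ℕ, Measurable c ∧ ∀ B ∈ 𝓑, B.patterns.Nonempty →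
      ∀ x ∈ B.dom, ∀ y ∈ B.dom, c x = c y → x = y := by
  classical
  let e := MeasureTheory.embeddingReal X
  have he := MeasureTheory.measurableEmbedding_embeddingReal X
  obtain ⟨q, hq⟩ := exists_surjective_nat (ℚ × ℚ)
  let U : ℕ → Set X := fun j => e ⁻¹' Set.Ioo ((q j).1 : ℝ) ((q j).2 : ℝ)
  have hU : ∀ j, MeasurableSet (U j) := fun j => he.measurable measurableSet_Ioo
  let Q : ℕ → Constraint X k → X → Prop := fun j B x => ∃ y ∈ B.dom, y ≠ x ∧ y ∈ U j
  -- The color of `x` is the first rational interval isolating `x` from its finitely many neighbors.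
  -- Neighbors of the same color would both lie in that interval.
  let p : X → ℕ → Prop := fun x j =>
    x ∈ U j ∧ ¬ ∃ B ∈ 𝓑, B.patterns.Nonempty ∧ x ∈ B.dom ∧ Q j B x
  have hp : ∀ x, ∃ j, p x j := by
    intro x
    have hfin : {B ∈ 𝓑 | x ∈ B.dom}.Finite := Set.finite_of_encard_le_coe (hd x)
    let F : Finset X := (hfin.toFinset.biUnion fun B => B.dom).erase x
    have hnhds : ((F.image e : Finset ℝ) : Set ℝ)ᶜ ∈ nhds (e x) := by
      refine (F.image e).finite_toSet.isClosed.isOpen_compl.mem_nhds ?_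
      simp only [Finset.coe_image, Set.mem_compl_iff, Set.mem_image, Finset.mem_coe, not_exists,
        not_and]
      intro y hy hyx
      exact (Finset.mem_erase.mp hy).1 (he.injective hyx)
    obtain ⟨l, u, hx, hlu⟩ := mem_nhds_iff_exists_Ioo_subset.mp hnhds
    obtain ⟨a, hla, hax⟩ := exists_rat_btwn hx.1
    obtain ⟨b, hxb, hbu⟩ := exists_rat_btwn hx.2
    obtain ⟨j, hj⟩ := hq (a, b)
    refine ⟨j, ?_, ?_⟩
    · simp only [U, hj]
      exact ⟨hax, hxb⟩
    · rintro ⟨B, hB, -, hxB, y, hy, hyx, hyU⟩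
      simp only [U, hj] at hyU
      refine hlu ⟨hla.trans hyU.1, hyU.2.trans hbu⟩ ?_
      refine Finset.mem_coe.mpr (Finset.mem_image_of_mem e (Finset.mem_erase.mpr ⟨hyx, ?_⟩))
      exact Finset.mem_biUnion.mpr ⟨B, hfin.mem_toFinset.mpr ⟨hB, hxB⟩, hy⟩
  have hpm : ∀ j, MeasurableSet {x | p x j} := by
    intro j
    refine (hU j).inter (hB.measurableSet_exists_constraint hd (Q j) fun n P i => ?_).compl
    have : {t : Fin n → X | Function.Injective t ∧ Q j (ofTuple t P) (t i)} =
        {t | Function.Injective t} ∩ ⋃ i' : Fin n, {t | t i' ≠ t i} ∩ {t | t i' ∈ U j} := by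
      ext t
      simp [Q, mem_dom_ofTuple]
    rw [this]
    refine (measurableSet_setOf_injective n).inter (MeasurableSet.iUnion fun i' => ?_)
    exact (measurableSet_eq_fun (measurable_pi_apply i') (measurable_pi_apply i)).compl.inter
      (measurable_pi_apply i' (hU j))
  refine ⟨fun x => Nat.find (hp x), measurable_find hp hpm, fun B hB hne x hx y hy hxy => ?_⟩
  by_contra hne'
  have h1 := Nat.find_spec (hp x)
  have h2 := Nat.find_spec (hp y)
  simp only at hxy
  rw [hxy] at h1
  exact h1.2 ⟨B, hB, hne, hx, y, hy, Ne.symm hne', h2.1⟩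

/-- One round of the method of conditional probabilities: the points of color `m` are assigned
values in a Borel way so that no constraint becomes more than `d` times likelier. -/
theorem IsBorel.exists_measurable_step (hB : 𝓑.IsBorel) (hk : 0 < k) {d : ℕ}
    (hd : ∀ x, Set.encard {B ∈ 𝓑 | x ∈ B.dom} ≤ d) {c : X → ℕ} (hc : Measurable c)
    (hproper : ∀ B ∈ 𝓑, B.patterns.Nonempty → ∀ x ∈ B.dom, ∀ y ∈ B.dom, c x = c y → x = y)
    (m : ℕ) {f : X → Fin k} (hf : Measurable f) :
    ∃ f' : X → Fin k, Measurable f' ∧ (∀ x, c x ≠ m → f' x = f x) ∧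
      ∀ B ∈ 𝓑, B.patterns.Nonempty → ∀ x ∈ B.dom, c x = m →
        B.count (fun y => c y < m + 1) f' * k ≤ d * B.count (fun y => c y < m) f := by
  classical
  let Q : Fin k → Constraint X k → X → Prop := fun a B x =>
    d * B.count (fun y => c y < m) f <
      B.count (fun y => c y < m ∨ y = x) (Function.update f x a) * k
  let G : Fin k → Set X := fun a =>
    {x | c x = m → ¬ ∃ B ∈ 𝓑, B.patterns.Nonempty ∧ x ∈ B.dom ∧ Q a B x}
  have hG : ∀ a, MeasurableSet (G a) := by
    intro a
    have hmeas := hB.measurableSet_exists_constraint hd (Q a) fun n P i => by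
      let g : (Fin n → X) → Fin n → ℕ × Fin k := fun t j => (c (t j), f (t j))
      have hg : Measurable g := measurable_pi_lambda _ fun j =>
        (hc.comp (measurable_pi_apply j)).prodMk (hf.comp (measurable_pi_apply j))
      -- Badness depends only on the colors and values along the tuple, which range over a countable
      -- discrete space where every set is measurable.
      let T : Set (Fin n → ℕ × Fin k) := {s |
        d * (P.filter fun φ => ∀ j, (s j).1 < m → φ j = (s j).2).card <
          (P.filter fun φ => ∀ j, ((s j).1 < m ∨ j = i) →
            φ j = if j = i then a else (s j).2).card * k}
      have : {t : Fin n → X | Function.Injective t ∧ Q a (ofTuple t P) (t i)} =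
          {t | Function.Injective t} ∩ g ⁻¹' T := by
        ext t
        refine and_congr_right fun ht => ?_
        simp only [Q, T, g, count_ofTuple ht, Function.update_apply, ht.eq_iff, Set.mem_preimage,
          Set.mem_ofPred_eq]
        convert Iff.rfl
      rw [this]
      exact (measurableSet_setOf_injective n).inter (hg (MeasurableSet.of_discrete))
    have : G a = {x | c x = m}ᶜ ∪
        {x | ∃ B ∈ 𝓑, B.patterns.Nonempty ∧ x ∈ B.dom ∧ Q a B x}ᶜ := by
      ext x
      simp only [G, Set.mem_ofPred_eq, Set.mem_union, Set.mem_compl_iff]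
      exact imp_iff_not_or
    rw [this]
    exact (hc (measurableSet_singleton m)).compl.union hmeas.compl
  have hex : ∀ x, ∃ a, x ∈ G a := by
    intro x
    have hfin : {B ∈ 𝓑 | x ∈ B.dom}.Finite := Set.finite_of_encard_le_coe (hd x)
    have hcard : hfin.toFinset.card ≤ d := by
      have := hd x
      rw [hfin.encard_eq_coe_toFinset_card] at this
      exact_mod_cast this
    obtain ⟨a, ha⟩ := exists_forall_mul_le hfin.toFinset hcard hk fun B a =>
      B.count (fun y => c y < m ∨ y = x) (Function.update f x a)
    refine ⟨a, ?_⟩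
    rintro hcx ⟨B, hB, -, hxB, hQ⟩
    have h1 := ha B (hfin.mem_toFinset.mpr ⟨hB, hxB⟩)
    rw [B.sum_count_update (fun y => c y < m) f hxB (by simp [hcx])] at h1
    exact absurd hQ (not_lt.mpr h1)
  obtain ⟨g, hg, hgG⟩ := exists_measurable_selector G hG hex
  refine ⟨fun x => if c x = m then g x else f x,
    Measurable.ite (hc (measurableSet_singleton m)) hg hf, fun x hx => if_neg hx, ?_⟩
  intro B hB hne x hx hcx
  have h1 : ¬ Q (g x) B x := fun h => hgG x hcx ⟨B, hB, hne, hx, h⟩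
  refine le_trans (le_of_eq ?_) (not_lt.mp h1)
  congr 1
  -- Within `B` only `x` has color m, so the simultaneous update looks like an update at `x` alone.
  have hiff : ∀ y ∈ B.dom, c y = m ↔ y = x := fun y hy =>
    ⟨fun h => hproper B hB hne y hy x hx (h.trans hcx.symm), fun h => h ▸ hcx⟩
  refine B.count_congr (fun y hy => ?_) fun y hy _ => ?_
  · rw [← hiff y hy]
    omega
  · by_cases hyx : y = x
    · subst hyx
      simp [hcx]
    · simp [hyx, mt (hiff y hy).mp hyx]

/-- The Borel local lemma in terms of a uniform bound on the vertex degrees. -/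
theorem IsBorel.exists_measurable_isSolution (hB : 𝓑.IsBorel) (hk : 0 < k) {d : ℕ}
    (hd : ∀ x, Set.encard {B ∈ 𝓑 | x ∈ B.dom} ≤ d)
    (hlt : ∀ B ∈ 𝓑, B.patterns.card * d ^ B.dom.card < k ^ B.dom.card) :
    ∃ f : X → Fin k, Measurable f ∧ 𝓑.IsSolution f := by
  classical
  obtain ⟨c, hc, hproper⟩ := hB.exists_measurable_coloring hd
  choose step hstep_meas hstep_eq hstep using fun (m : ℕ) (f : {f : X → Fin k // Measurable f}) =>
    hB.exists_measurable_step hk hd hc hproper m f.2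
  let F : ℕ → {f : X → Fin k // Measurable f} := fun m =>
    Nat.rec ⟨fun _ => ⟨0, hk⟩, measurable_const⟩ (fun m f => ⟨step m f, hstep_meas m f⟩) m
  have hF : ∀ m, (F (m + 1)).1 = step m (F m) := fun _ => rfl
  have hstable : ∀ x m, c x < m → (F m).1 x = (F (c x + 1)).1 x := by
    intro x m hm
    induction m, Nat.succ_le_of_lt hm using Nat.le_induction with
    | base => rfl
    | succ m hle ih =>
      rw [hF m, hstep_eq m (F m) x (Nat.ne_of_lt hle)]
      exact ih hle
  -- Divided by k^|dom(B)|, this says that the conditional probability has grown by at most a factor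
  -- d per decided point.
  have hinv : ∀ B ∈ 𝓑, B.patterns.Nonempty → ∀ m,
      B.count (fun y => c y < m) (F m).1 * k ^ (B.dom.filter fun y => c y < m).card ≤
        B.patterns.card * d ^ (B.dom.filter fun y => c y < m).card := by
    intro B hB hne m
    induction m with
    | zero =>
      simp only [not_lt_zero, Finset.filter_false, Finset.card_empty, pow_zero, mul_one]
      exact B.count_le _ _
    | succ m ih =>
      by_cases hx : ∃ x ∈ B.dom, c x = m
      · obtain ⟨x, hx, hcx⟩ := hx
        have hins : (B.dom.filter fun y => c y < m + 1) =
            insert x (B.dom.filter fun y => c y < m) := by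
          ext y
          simp only [Finset.mem_filter, Finset.mem_insert]
          constructor
          · rintro ⟨hy, hcy⟩
            rcases Nat.lt_succ_iff_lt_or_eq.mp hcy with h | h
            · exact Or.inr ⟨hy, h⟩
            · exact Or.inl (hproper B hB hne y hy x hx (h.trans hcx.symm))
          · rintro (rfl | ⟨hy, hcy⟩)
            · exact ⟨hx, by omega⟩
            · exact ⟨hy, by omega⟩
        have hnot : x ∉ B.dom.filter fun y => c y < m := by simp [hcx]
        rw [hins, Finset.card_insert_of_notMem hnot, pow_succ, pow_succ, hF]
        have h1 := hstep m (F m) B hB hne x hx hcx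
        set s := (B.dom.filter fun y => c y < m).card
        calc B.count (fun y => c y < m + 1) (step m (F m)) * (k ^ s * k)
            = B.count (fun y => c y < m + 1) (step m (F m)) * k * k ^ s := by ring
          _ ≤ d * B.count (fun y => c y < m) (F m).1 * k ^ s := Nat.mul_le_mul_right _ h1
          _ = B.count (fun y => c y < m) (F m).1 * k ^ s * d := by ring
          _ ≤ B.patterns.card * d ^ s * d := Nat.mul_le_mul_right _ ih
          _ = B.patterns.card * (d ^ s * d) := by ring
      · push Not at hx
        have hiff : ∀ y ∈ B.dom, c y < m + 1 ↔ c y < m := fun y hy => by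
          have := hx y hy
          omega
        rw [Finset.filter_congr hiff, B.count_congr hiff (f' := (F m).1) fun y hy _ => by
          rw [hF, hstep_eq m (F m) y (hx y hy)]]
        exact ih
  -- The value at `x` is final after round `c x`; countably many rounds keep the limit Borel.
  refine ⟨fun x => (F (c x + 1)).1 x, ?_, ?_⟩
  · exact (measurable_from_prod_countable_right (f := fun q : ℕ × X => (F (q.1 + 1)).1 q.2)
      fun m => (F (m + 1)).2).comp (hc.prodMk measurable_id)
  · intro B hB hviol
    have hne : B.patterns.Nonempty := ⟨_, hviol⟩
    obtain ⟨M, hM⟩ : ∃ M, ∀ y ∈ B.dom, c y < M :=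
      ⟨B.dom.sup c + 1, fun y hy => Nat.lt_succ_of_le (Finset.le_sup hy)⟩
    have h1 := hinv B hB hne M
    rw [Finset.filter_true_of_mem hM] at h1
    have hpos : 1 ≤ B.count (fun y => c y < M) (F M).1 :=
      Violates.count_pos hviol fun y _ hy => (hstable y M hy).symm
    have h2 := Nat.mul_le_mul_right (k ^ B.dom.card) hpos
    have h3 := hlt B hB
    omega

end CSP

/-! ### Reduction to a finite degree bound, with the degenerate exponents. -/

theorem corollary1p3 {X : Type*} [MeasurableSpace X] [StandardBorelSpace X]
    (k : ℕ) (hk : 0 < k) (𝓑 : CSP X k) (hB : 𝓑.IsBorel)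
    (h : 𝓑.p * ((𝓑.vdeg ^ 𝓑.ord : ℕ∞) : ℝ≥0∞) < 1) :
    ∃ f : X → Fin k, Measurable f ∧ 𝓑.IsSolution f := by
  have hk0 : (k : ℝ≥0∞) ≠ 0 := by exact_mod_cast hk.ne'
  have hprob : ∀ B ∈ 𝓑, B.prob ≤ 𝓑.p := fun B hB => le_iSup₂_of_le B hB le_rfl
  have hord : ∀ B ∈ 𝓑, (B.dom.card : ℕ∞) ≤ 𝓑.ord := fun B hB => le_iSup₂_of_le B hB le_rfl
  have hvdeg : ∀ x, Set.encard {B ∈ 𝓑 | x ∈ B.dom} ≤ 𝓑.vdeg := fun x => le_iSup_of_le x le_rfl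
  -- Here `vdeg ^ ord` may be infinite, but no constraint has a pattern, so any constant works.
  by_cases hp : 𝓑.p = 0
  · refine ⟨fun _ => ⟨0, hk⟩, measurable_const, fun B hB hviol => ?_⟩
    have h0 : B.prob = 0 := nonpos_iff_eq_zero.mp (hp ▸ hprob B hB)
    rw [Constraint.prob, ENNReal.div_eq_zero_iff] at h0
    rcases h0 with h0 | h0
    · rw [Nat.cast_eq_zero, Finset.card_eq_zero] at h0
      exact absurd hviol (by simp [Constraint.Violates, h0])
    · exact ENNReal.pow_ne_top (ENNReal.natCast_ne_top k) h0
  have hmul : ∀ B ∈ 𝓑, ∀ d : ℕ, ((d ^ B.dom.card : ℕ) : ℕ∞) ≤ 𝓑.vdeg ^ 𝓑.ord →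
      B.patterns.card * d ^ B.dom.card < k ^ B.dom.card := by
    intro B hB d hle
    have h1 : B.prob * ((d ^ B.dom.card : ℕ) : ℝ≥0∞) < 1 := by
      refine (mul_le_mul' (hprob B hB) ?_).trans_lt h
      have := ENat.toENNReal_le.mpr hle
      rwa [ENat.toENNReal_coe] at this
    have hpow0 : (k : ℝ≥0∞) ^ B.dom.card ≠ 0 := pow_ne_zero _ hk0
    have hpowt : (k : ℝ≥0∞) ^ B.dom.card ≠ ⊤ := ENNReal.pow_ne_top (ENNReal.natCast_ne_top k)
    rw [Constraint.prob, ENNReal.mul_comm_div, ← mul_div_assoc,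
      ENNReal.div_lt_iff (Or.inl hpow0) (Or.inl hpowt), one_mul] at h1
    exact_mod_cast h1
  -- All domains are empty, so the degree bound 0 is valid, and 0^0 = 1 matches `vdeg ^ 0`.
  by_cases hr : 𝓑.ord = 0
  · have hdom : ∀ B ∈ 𝓑, B.dom = ∅ := fun B hB => by
      have := hord B hB
      rw [hr, nonpos_iff_eq_zero] at this
      exact Finset.card_eq_zero.mp (by exact_mod_cast this)
    refine hB.exists_measurable_isSolution hk (d := 0) (fun x => ?_) fun B hB => hmul B hB 0 ?_
    · rw [Nat.cast_zero, nonpos_iff_eq_zero, Set.encard_eq_zero, Set.eq_empty_iff_forall_notMem]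
      rintro B ⟨hB, hx⟩
      simp [hdom B hB] at hx
    · simp [hdom B hB, hr]
  have htop : 𝓑.vdeg ≠ ⊤ := by
    intro ht
    rw [ht, ENat.top_epow hr, ENat.toENNReal_top, ENNReal.mul_top hp] at h
    exact absurd h (by simp)
  obtain ⟨d, hd⟩ := ENat.ne_top_iff_exists.mp htop
  refine hB.exists_measurable_isSolution hk (d := d) (fun x => hd ▸ hvdeg x) fun B hB =>
    hmul B hB d ?_
  -- Monotonicity in the exponent needs a nonzero base; d = 0 would make every domain empty, against
  -- `hr`.
  by_cases hd0 : d = 0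
  · exfalso
    apply hr
    refine nonpos_iff_eq_zero.mp (iSup₂_le fun B hB => ?_)
    rw [nonpos_iff_eq_zero, Nat.cast_eq_zero, Finset.card_eq_zero,
      Finset.eq_empty_iff_forall_notMem]
    intro x hx
    have h1 := hvdeg x
    rw [← hd, hd0, Nat.cast_zero, nonpos_iff_eq_zero, Set.encard_eq_zero] at h1
    exact (h1 ▸ (⟨hB, hx⟩ : B ∈ {B ∈ 𝓑 | x ∈ B.dom}) : B ∈ (∅ : Set _))
  · rw [← hd, Nat.cast_pow, ← ENat.epow_natCast]
    exact ENat.epow_right_mono (by exact_mod_cast hd0) (hord B hB)
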